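/- Let $A$ be a finite unitary ring (not necessarily commutative) that is a free left module over a unitary subring $R$, let $\mathcal{B}=(v_1,\dots,v_r)$ be an ordered left $R$-basis of $A$, and let $\sigma$ be an involution of $A$ (an anti-automorphism with $\sigma^2=\mathrm{id}$) such that $\sigma(R)=R$. Let $H$ be a subgroup of the group $\mathrm{Aut}(A)$ of ring automorphisms such that $R\subseteq A^H=\{a\in A : h(a)=a \text{ for all } h\in H\}$, and put $\mathrm{Tr}_H(a)=\sum_{h\in H}h(a)$. Assume that $A$ and $R$ are Frobenius rings, where a finite ring $S$ is Frobenius if $S/J(S)\cong \mathrm{Soc}(S)$ both as left and as right $S$-modules ($J(S)$ being the Jacobson radical and $\mathrm{Soc}(S)$ the left, respectively right, socle of $S$). Assume that $\mathcal{B}$ is $\sigma$-pseudo-self-dual with respect to $H$: for all $i,j$ one has $\mathrm{Tr}_H(v_i\sigma(v_j))=0$ if and only if $i\neq j$, and there is $\gamma\in A$ that is not a zero divisor, commutes with every element of $R$, and satisfies $\mathrm{Tr}_H(v_i\sigma(v_i))=\gamma$ for all $i$. For $x,y\in A^k$ let $\langle x,y\rangle_{A^k}=\sum_{i=1}^k x_i\sigma(y_i)$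 be the standard $\sigma$-hermitian form, and for $C\subseteq A^k$ let $C^\perp=\{v\in A^k : \langle v,c\rangle_{A^k}=0 \text{ for all } c\in C\}$; duals in $R^k$ are defined in the same way with $\sigma|_R$ in place of $\sigma$. Let $\rho:A\to R^r$ be the map $a_1v_1+\dots+a_rv_r\mapsto(a_1,\dots,a_r)$ and, for $n\in\mathbb{N}$, let $\Phi:A^n\to R^{rn}$ be the map $(\alpha_1,\dots,\alpha_n)\mapsto(\rho(\alpha_1),\dots,\rho(\alpha_n))$. Then for every $n\in\mathbb{N}$ and every linear code $C$ of length $n$ over $A$ (that is, every left $A$-submodule $C\subseteq A^n$), $$\Phi(C^\perp)=\Phi(C)^\perp .$$ -/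

import Mathlib

open MulOpposite

namespace DualityBases

/-- The socle of a module: the sum of all its simple submodules. -/
def socle (R M : Type*) [Ring R] [AddCommGroup M] [Module R M] : Submodule R M :=
  sSup {S : Submodule R M | IsSimpleModule R S}

/-- A (finite, or more generally Artinian) ring `R` is Frobenius if `R / J(R)` is isomorphic to
the socle of `R` both as left `R`-modules and as right `R`-modules, where `J(R)` is the Jacobson
radical.  Right modules are modules over `Rᵐᵒᵖ`.  The radical is written as the intersection of the
maximal left ideals in the first clause, and as the intersection of the maximal right ideals in the
second; these are the same subset of `R`. -/
def IsFrobeniusRing (R : Type*) [Ring R] : Prop :=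
  Nonempty ((R ⧸ Module.jacobson R R) ≃ₗ[R] socle R R) ∧
    Nonempty ((R ⧸ Module.jacobson Rᵐᵒᵖ R) ≃ₗ[Rᵐᵒᵖ] socle Rᵐᵒᵖ R)

/-- The restriction of an involution `σ` (an involutory anti-automorphism) of `A`
to a subring `R` with `σ(R) = R`. -/
def restrictInvo {A : Type*} [Ring A] (σ : RingInvo A) (R : Subring A)
    (hσ : (fun a : A => unop (σ a)) '' (R : Set A) = (R : Set A)) : RingInvo R :=
  have hmem : ∀ a : R, unop (σ (a : A)) ∈ R := fun a =>
    SetLike.mem_coe.1 (hσ ▸ Set.mem_image_of_mem _ a.2)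
  RingInvo.mk'
    { toFun := fun a => op ⟨unop (σ (a : A)), hmem a⟩
      map_one' := by
        apply unop_injective; ext; simp
      map_mul' := fun a b => by
        apply unop_injective; ext; simp
      map_zero' := by
        apply unop_injective; ext; simp
      map_add' := fun a b => by
        apply unop_injective; ext; simp }
    (fun a => by ext; exact σ.involution a)

/-- The standard `σ`-hermitian form `⟨x, y⟩ = ∑ i, x i * σ (y i)` on `A ^ k`. -/
def hermForm {A : Type*} [Ring A] (σ : RingInvo A) {k : ℕ} (x y : Fin k → A) : A :=
  ∑ i, x i * unop (σ (y i))

/-- The dual code `C^⊥ = {v | ⟨v, c⟩ = 0 for all c ∈ C}` for the standard `σ`-hermitian form. -/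
def dualCode {A : Type*} [Ring A] (σ : RingInvo A) {k : ℕ} (C : Set (Fin k → A)) :
    Set (Fin k → A) :=
  {v | ∀ c ∈ C, hermForm σ v c = 0}

/-- The trace `Tr_H(a) = ∑ h ∈ H, h a`.  When `A` is finite the index set is finite, so that the
`finsum` is the actual sum. -/
noncomputable def trace {A : Type*} [Ring A] (H : Subgroup (RingAut A)) (a : A) : A :=
  ∑ᶠ h : H, (h : RingAut A) a

/-- `v` is `σ`-trace orthogonal with respect to `H`: `Tr_H(v_i σ(v_j)) = 0` iff `i ≠ j`. -/
def IsTraceOrthogonal {A : Type*} [Ring A] (σ : RingInvo A) (H : Subgroup (RingAut A)) {r : ℕ}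
    (v : Fin r → A) : Prop :=
  ∀ i j, trace H (v i * unop (σ (v j))) = 0 ↔ i ≠ j

/-- `v` is `σ`-pseudo-self-dual over `R` with respect to `H`: it is `σ`-trace orthogonal and there
is `γ`, not a zero divisor and commuting with every element of `R`, such that
`Tr_H(v_i σ(v_i)) = γ` for all `i`. -/
def IsPseudoSelfDual {A : Type*} [Ring A] (σ : RingInvo A) (R : Subring A)
    (H : Subgroup (RingAut A)) {r : ℕ} (v : Fin r → A) : Prop :=
  IsTraceOrthogonal σ H v ∧
    ∃ γ : A, γ ∈ nonZeroDivisors A ∧ (∀ a ∈ R, γ * a = a * γ) ∧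
      ∀ i, trace H (v i * unop (σ (v i))) = γ

/-- The coordinate map `Φ : A ^ n → R ^ (n r)`, `(α_1, …, α_n) ↦ (ρ(α_1), …, ρ(α_n))`, where `ρ`
sends `a_1 v_1 + ⋯ + a_r v_r` to `(a_1, …, a_r)`.  The pair `(i, j)` has position `i * r + j`
(counting from `0`), which is the order of concatenation. -/
noncomputable def coordMap {A : Type*} [Ring A] {R : Subring A} {r : ℕ}
    (v : Module.Basis (Fin r) R A) {n : ℕ} (x : Fin n → A) : Fin (n * r) → R :=
  fun k => v.repr (x (finProdFinEquiv.symm k).1) (finProdFinEquiv.symm k).2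

end DualityBases

open DualityBases

/-!
The proof rests on one identity: for `x, y ∈ A ^ n`,
`Tr_H ⟨x, y⟩ = ⟨Φ x, Φ y⟩ γ` (`trace_hermForm`). Indeed `H` fixes `R` pointwise, so `Tr_H` is
`R`-linear on both sides, and expanding `x σ(y)` in the basis leaves only the diagonal terms
`a_i Tr_H(v_i σ(v_i)) σ(b_i) = a_i γ σ(b_i) = a_i σ(b_i) γ`.

Since `γ` is not a zero divisor, `Φ x` is orthogonal to `Φ y` iff `Tr_H ⟨x, y⟩ = 0`. If `x ∈ C^⊥`,
this gives `Φ x ∈ Φ(C)^⊥`. Conversely, if `Tr_H ⟨x, c⟩ = 0` for all `c ∈ C`, then, `C` being a left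
`A`-submodule, also `Tr_H(⟨x, c⟩ σ(a)) = Tr_H ⟨x, a c⟩ = 0` for all `a ∈ A`. The trace form is
nondegenerate (`eq_zero_of_trace_mul_invo_eq_zero`): if `b = ∑ b_i v_i`, then
`Tr_H(b σ(v_i)) = b_i γ`, so its vanishing for all `i` forces `b = 0`. Hence `⟨x, c⟩ = 0`.
-/

namespace DualityBases

section Trace

variable {A : Type*} [Ring A] (H : Subgroup (RingAut A))

theorem trace_zero : trace H (0 : A) = 0 := by
  simp [trace]

variable [Finite A]

theorem finite_subgroup_ringAut : Finite H :=
  have : Finite (RingAut A) := DFunLike.finite (A ≃+* A)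
  inferInstance

theorem trace_add (a b : A) : trace H (a + b) = trace H a + trace H b := by
  have := finite_subgroup_ringAut H
  simp only [trace, map_add]
  exact finsum_add_distrib (Set.toFinite _) (Set.toFinite _)

theorem trace_sum {ι : Type*} (s : Finset ι) (f : ι → A) :
    trace H (∑ i ∈ s, f i) = ∑ i ∈ s, trace H (f i) :=
  map_sum (⟨⟨trace H, trace_zero H⟩, trace_add H⟩ : A →+ A) f s

theorem trace_mul_of_fixed_left {a : A} (ha : a ∈ FixedPoints.subring A H) (b : A) :
    trace H (a * b) = a * trace H b := by
  have := finite_subgroup_ringAut H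
  have h : ∀ h : H, (h : RingAut A) a = a := ha
  simp only [trace, map_mul, h]
  exact (mul_finsum' _ _ (Set.toFinite _)).symm

theorem trace_mul_of_fixed_right {a : A} (ha : a ∈ FixedPoints.subring A H) (b : A) :
    trace H (b * a) = trace H b * a := by
  have := finite_subgroup_ringAut H
  have h : ∀ h : H, (h : RingAut A) a = a := ha
  simp only [trace, map_mul, h]
  exact (finsum_mul' _ _ (Set.toFinite _)).symm

end Trace

section Form

variable {A : Type*} [Ring A] (σ : RingInvo A)

theorem hermForm_smul_right {k : ℕ} (a : A) (x y : Fin k → A) :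
    hermForm σ x (a • y) = hermForm σ x y * unop (σ a) := by
  simp [hermForm, Finset.sum_mul, mul_assoc]

@[simp]
theorem coe_unop_restrictInvo (R : Subring A)
    (hσ : (fun a : A => unop (σ a)) '' (R : Set A) = (R : Set A)) (a : R) :
    ((unop (restrictInvo σ R hσ a) : R) : A) = unop (σ (a : A)) :=
  rfl

theorem coordMap_surjective {R : Subring A} {r : ℕ} (v : Module.Basis (Fin r) R A) (n : ℕ) :
    Function.Surjective (coordMap v : (Fin n → A) → Fin (n * r) → R) := by
  intro w
  refine ⟨fun i => v.equivFun.symm fun j => w (finProdFinEquiv (i, j)), ?_⟩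
  ext k
  change ((v.equivFun (v.equivFun.symm _) _ : R) : A) = _
  rw [LinearEquiv.apply_symm_apply]
  exact congrArg (fun l => ((w l : R) : A)) (finProdFinEquiv.apply_symm_apply k)

/-- The form on `R ^ (n r)`, computed block by block in coordinates. -/
theorem coe_hermForm_coordMap (R : Subring A)
    (hσ : (fun a : A => unop (σ a)) '' (R : Set A) = (R : Set A)) {r : ℕ}
    (v : Module.Basis (Fin r) R A) {n : ℕ} (x y : Fin n → A) :
    ((hermForm (restrictInvo σ R hσ) (coordMap v x) (coordMap v y) : R) : A) =
      ∑ i, ∑ j, (v.repr (x i) j : A) * unop (σ (v.repr (y i) j : A)) := by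
  rw [← Fintype.sum_prod_type', ← finProdFinEquiv.symm.sum_comp]
  simp [hermForm, coordMap]

end Form

section PseudoSelfDual

variable {A : Type*} [Ring A] [Finite A] {R : Subring A} {σ : RingInvo A}
  {H : Subgroup (RingAut A)} {r : ℕ} {v : Module.Basis (Fin r) R A} {γ : A}

theorem trace_mul_invo_basis (hH : R ≤ FixedPoints.subring A H)
    (hv : IsTraceOrthogonal σ H v) (hγ : ∀ i, trace H (v i * unop (σ (v i))) = γ)
    (a : A) (j : Fin r) :
    trace H (a * unop (σ (v j))) = (v.repr a j : A) * γ := by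
  conv_lhs => rw [← v.sum_repr a]
  simp only [Finset.sum_mul, trace_sum, Subring.smul_def, smul_eq_mul, mul_assoc]
  rw [Finset.sum_eq_single j]
  · rw [trace_mul_of_fixed_left H (hH (v.repr a j).2), hγ]
  · intro i _ hij
    rw [trace_mul_of_fixed_left H (hH (v.repr a i).2), (hv i j).2 hij, mul_zero]
  · simp

/-- The trace form `(a, b) ↦ Tr_H(a σ(b))` in coordinates. -/
theorem trace_mul_invo (hσ : (fun a : A => unop (σ a)) '' (R : Set A) = (R : Set A))
    (hH : R ≤ FixedPoints.subring A H)
    (hv : IsTraceOrthogonal σ H v) (hcomm : ∀ a ∈ R, γ * a = a * γ)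
    (hγ : ∀ i, trace H (v i * unop (σ (v i))) = γ) (a b : A) :
    trace H (a * unop (σ b)) =
      (∑ j, (v.repr a j : A) * unop (σ (v.repr b j : A))) * γ := by
  have hmem (j : Fin r) : unop (σ (v.repr b j : A)) ∈ R :=
    (unop (restrictInvo σ R hσ (v.repr b j))).2
  conv_lhs => rw [← v.sum_repr b]
  simp only [map_sum, Finset.unop_sum, Finset.mul_sum, trace_sum, Finset.sum_mul,
    Subring.smul_def, smul_eq_mul, map_mul, unop_mul, ← mul_assoc]
  refine Finset.sum_congr rfl fun j _ => ?_
  rw [trace_mul_of_fixed_right H (hH (hmem j)), trace_mul_invo_basis hH hv hγ, mul_assoc,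
    hcomm _ (hmem j), mul_assoc]

theorem trace_hermForm (hσ : (fun a : A => unop (σ a)) '' (R : Set A) = (R : Set A))
    (hH : R ≤ FixedPoints.subring A H)
    (hv : IsTraceOrthogonal σ H v) (hcomm : ∀ a ∈ R, γ * a = a * γ)
    (hγ : ∀ i, trace H (v i * unop (σ (v i))) = γ) {n : ℕ} (x y : Fin n → A) :
    trace H (hermForm σ x y) =
      ((hermForm (restrictInvo σ R hσ) (coordMap v x) (coordMap v y) : R) : A) * γ := by
  rw [coe_hermForm_coordMap, hermForm, trace_sum, Finset.sum_mul]
  exact Finset.sum_congr rfl fun i _ => trace_mul_invo hσ hH hv hcomm hγ _ _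

/-- Nondegeneracy of the trace form in its first argument. -/
theorem eq_zero_of_trace_mul_invo_eq_zero (hH : R ≤ FixedPoints.subring A H)
    (hv : IsTraceOrthogonal σ H v) (hreg : γ ∈ nonZeroDivisors A)
    (hγ : ∀ i, trace H (v i * unop (σ (v i))) = γ) {b : A}
    (hb : ∀ a, trace H (b * unop (σ a)) = 0) : b = 0 := by
  refine v.ext_elem fun j => Subtype.ext ?_
  have h := hb (v j)
  rw [trace_mul_invo_basis hH hv hγ] at h
  simpa using hreg.2 _ h

end PseudoSelfDual

end DualityBases

open DualityBases
theorem theorem3p4 {A : Type*} [Ring A] [Finite A] (R : Subring A) (σ : RingInvo A)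
    (hσ : (fun a : A => unop (σ a)) '' (R : Set A) = (R : Set A))
    {r : ℕ} (v : Module.Basis (Fin r) R A)
    (H : Subgroup (RingAut A)) (hH : R ≤ FixedPoints.subring A H)
    (hA : IsFrobeniusRing A) (hR : IsFrobeniusRing R)
    (hv : IsPseudoSelfDual σ R H v)
    (n : ℕ) (C : Submodule A (Fin n → A)) :
    coordMap v '' dualCode σ (C : Set (Fin n → A)) =
      dualCode (restrictInvo σ R hσ) (coordMap v '' (C : Set (Fin n → A))) := by
  obtain ⟨hv, γ, hreg, hcomm, hγ⟩ := hv
  ext w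
  constructor
  · rintro ⟨x, hx, rfl⟩ _ ⟨c, hc, rfl⟩
    have h := trace_hermForm hσ hH hv hcomm hγ x c
    rw [hx c hc, trace_zero] at h
    exact Subtype.ext (hreg.2 _ h.symm)
  · intro hw
    obtain ⟨x, rfl⟩ := coordMap_surjective v n w
    refine ⟨x, fun c hc => eq_zero_of_trace_mul_invo_eq_zero hH hv hreg hγ fun a => ?_, rfl⟩
    rw [← hermForm_smul_right, trace_hermForm hσ hH hv hcomm hγ,
      hw _ ⟨a • c, C.smul_mem a hc, rfl⟩, ZeroMemClass.coe_zero, zero_mul]
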